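/- Let $\mathcal X\subset\mathbb R^d$ be compact and convex with Euclidean diameter $D$, let $x_0\in\mathcal X$, $G\ge 0$ and $T\in\mathbb N$. An input consists of a convex function $f:\mathcal X\to\mathbb R$ that is $G$-Lipschitz on $\mathcal X$ and of closed convex sets $\mathcal X=S_0\supseteq S_1\supseteq\dots\supseteq S_T\neq\emptyset$; the function $f$ is known in advance and $S_t$ is revealed in round $t$. The Level Set Projection algorithm (LSP) with tolerance $\varepsilon>0$ starts with $p=1$, $L_1=\min_{S_1}f$ and the action $x_0$. In each round $t=1,\dots,T$, it observes $S_t$ and forms $\Phi_t=\{x\in S_t: f(x)\le L_p+\varepsilon\}$; if $\Phi_t=\emptyset$, it increases $p$ by one, sets $L_p=\min_{S_t}f$ and forms $\Phi_t=\{x\in S_t: f(x)\le L_p+\varepsilon\}$ anew; then it plays $x_t=\Pi_{\Phi_t}(x_{t-1})$, the Euclidean projection of $x_{t-1}$ onto $\Phi_t$. Let $$\mathrm{Regret}_{\mathrm{LSP}}(T)=\sup_{f,(S_t)}\Big\{\sum_{t=1}^T f(x_t)-T\min_{x\in S_T}f(x)\Big\},\qquad M_{\mathrm{LSP}}(T)=\sum_{t=1}^T\|x_t-x_{t-1}\|_2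 ,$$ where the supremum is over all inputs. There is an absolute constant $C>0$ such that, for all $d,\mathcal X,x_0,G,T$ as above and with the convention $0^0=1$: 1. For every $\varepsilon>0$, $\mathrm{Regret}_{\mathrm{LSP}}(T)\le T\varepsilon$, and for every input the actions are feasible ($x_t\in S_t$ for $1\le t\le T$) and $$M_{\mathrm{LSP}}(T)\le C\,d^{d/2}D\Big(\frac{GD}{\varepsilon}+1\Big);$$ if moreover $\varepsilon\le GD$, then $$M_{\mathrm{LSP}}(T)\le C\,\frac{d^{d/2}\,G\,D^2}{\varepsilon}.$$ 2. If $T\ge1$, $\beta\in[0,1]$ and $\varepsilon=T^{-\beta}$, then $\mathrm{Regret}_{\mathrm{LSP}}(T)\le T^{1-\beta}$, and for every input $M_{\mathrm{LSP}}(T)\le C\,d^{d/2}D\,(GD+1)\,T^{\beta}$. That is, for fixed $d,D,G$ the (regret, movement cost) tuple is $(O(T^{1-\beta}),O(T^{\beta}))$. -/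

import Mathlib

open scoped NNReal

noncomputable section

/-- The space `ℝ^d` with the Euclidean norm. -/
abbrev Euc (d : ℕ) : Type := EuclideanSpace ℝ (Fin d)

/-- An input of the problem CONES with horizon `T`: a convex `G`-Lipschitz loss `f` on the
admissible set `X` and closed convex sets `X = S 0 ⊇ S 1 ⊇ ⋯ ⊇ S T ≠ ∅`.
Only the sets `S t` with `t ≤ T` and the values of `f` on `X` matter. -/
structure IsCONESInput {d : ℕ} (X : Set (Euc d)) (G : ℝ≥0) (T : ℕ)
    (f : Euc d → ℝ) (S : ℕ → Set (Euc d)) : Prop where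
  convexOn : ConvexOn ℝ X f
  lipschitz : LipschitzOnWith G f X
  start : S 0 = X
  nested : ∀ t < T, S (t + 1) ⊆ S t
  isClosed : ∀ t ≤ T, IsClosed (S t)
  convex : ∀ t ≤ T, Convex ℝ (S t)
  nonempty : (S T).Nonempty

/-- The minimum of `f` on `K` (attained when `K` is nonempty and compact and `f` is continuous
on `K`, see `exists_eq_minValue`). -/
def minValue {d : ℕ} (f : Euc d → ℝ) (K : Set (Euc d)) : ℝ := sInf (f '' K)

theorem exists_eq_minValue {d : ℕ} {f : Euc d → ℝ} {K : Set (Euc d)} (hK : IsCompact K)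
    (hne : K.Nonempty) (hf : ContinuousOn f K) :
    ∃ x ∈ K, f x = minValue f K ∧ ∀ y ∈ K, f x ≤ f y := by
  obtain ⟨x, hx, h, h'⟩ := hK.exists_sInf_image_eq_and_le hne hf
  exact ⟨x, hx, h.symm, h'⟩

open Classical in
/-- The Euclidean projection of `x` onto `K`: a point of `K` nearest to `x`
(it exists for nonempty closed `K`, see `metricProj_spec`, and is unique if `K` is also convex;
the value is `x` if there is no nearest point). -/
def metricProj {d : ℕ} (K : Set (Euc d)) (x : Euc d) : Euc d :=
  if h : ∃ y ∈ K, ∀ z ∈ K, ‖x - y‖ ≤ ‖x - z‖ then h.choose else x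

theorem metricProj_spec {d : ℕ} {K : Set (Euc d)} (hne : K.Nonempty) (hc : IsClosed K)
    (x : Euc d) :
    metricProj K x ∈ K ∧ ∀ z ∈ K, ‖x - metricProj K x‖ ≤ ‖x - z‖ := by
  have h : ∃ y ∈ K, ∀ z ∈ K, ‖x - y‖ ≤ ‖x - z‖ := by
    obtain ⟨y, hy, hxy⟩ := hc.exists_infDist_eq_dist hne x
    refine ⟨y, hy, fun z hz => ?_⟩
    rw [← dist_eq_norm, ← dist_eq_norm, ← hxy]
    exact Metric.infDist_le_dist_of_mem hz
  rw [metricProj, dif_pos h]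
  exact h.choose_spec

/-- The active set `{x ∈ S : f x ≤ L + ε}`. -/
def activeSet {d : ℕ} (f : Euc d → ℝ) (ε L : ℝ) (S : Set (Euc d)) : Set (Euc d) :=
  {x ∈ S | f x ≤ L + ε}

/-- The memory of the Level Set Projection algorithm: phase index, level of the phase, and
last action. -/
structure LSPState (d : ℕ) where
  phase : ℕ
  level : ℝ
  action : Euc d

open Classical in
/-- One round of the Level Set Projection algorithm with tolerance `ε`, when the set `S` is
revealed: if the active set at the current level is empty, a new phase is started whose level
is the minimum of `f` on `S`; then the last action is projected onto the active set. -/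
def lspStep {d : ℕ} (f : Euc d → ℝ) (ε : ℝ) (S : Set (Euc d)) (s : LSPState d) : LSPState d :=
  if activeSet f ε s.level S = ∅ then
    { phase := s.phase + 1
      level := minValue f S
      action := metricProj (activeSet f ε (minValue f S) S) s.action }
  else
    { phase := s.phase
      level := s.level
      action := metricProj (activeSet f ε s.level S) s.action }

/-- The state of the Level Set Projection algorithm after round `t`. -/
def lspState {d : ℕ} (f : Euc d → ℝ) (ε : ℝ) (S : ℕ → Set (Euc d)) (x₀ : Euc d) :
    ℕ → LSPState d
  | 0 => { phase := 1, level := minValue f (S 1), action := x₀ }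
  | t + 1 => lspStep f ε (S (t + 1)) (lspState f ε S x₀ t)

/-- The actions `x₀, x₁, x₂, …` of the Level Set Projection algorithm with tolerance `ε`. -/
def lspAction {d : ℕ} (f : Euc d → ℝ) (ε : ℝ) (S : ℕ → Set (Euc d)) (x₀ : Euc d) (t : ℕ) :
    Euc d :=
  (lspState f ε S x₀ t).action

/-- The total loss `∑_{t=1}^T f(x_t)`. -/
def lossCost {d : ℕ} (f : Euc d → ℝ) (x : ℕ → Euc d) (T : ℕ) : ℝ :=
  ∑ t ∈ Finset.Icc 1 T, f (x t)

/-- The total movement cost `∑_{t=1}^T ‖x_t - x_{t-1}‖`. -/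
def movementCost {d : ℕ} (x : ℕ → Euc d) (T : ℕ) : ℝ :=
  ∑ t ∈ Finset.Icc 1 T, ‖x t - x (t - 1)‖

/-- The loss `T · min_{S_T} f` of the static benchmark that plays a minimizer of `f` on `S_T`
in all rounds. -/
def optLossCost {d : ℕ} (f : Euc d → ℝ) (S : ℕ → Set (Euc d)) (T : ℕ) : ℝ :=
  T * minValue f (S T)

/-- The regret of the Level Set Projection algorithm with tolerance `ε` started at `x₀`: the
supremum, over all inputs with horizon `T`, of its total loss minus that of the benchmark. -/
def lspRegret {d : ℕ} (X : Set (Euc d)) (G : ℝ≥0) (x₀ : Euc d) (ε : ℝ) (T : ℕ) : EReal :=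
  ⨆ (f : Euc d → ℝ) (S : ℕ → Set (Euc d)) (_ : IsCONESInput X G T f S),
    ((lossCost f (lspAction f ε S x₀) T - optLossCost f S T : ℝ) : EReal)

end

/-! Every level is the minimum of `f` over some `S r`, so each action costs at most `min_{S_T} f +
ε`; this gives the regret. Each new level exceeds the previous one by more than `ε`, while all of
them lie within `G * diam X` of each other, so there are at most `G * diam X / ε + 1` phases. Within
a phase the actions are successive projections onto nested closed convex sets, and such a path has
length at most `2 * 8 ^ d * diam X` (`IsProjectionPath.length_le`). The argument is
integral-geometric. For a direction `θ`, the maximum of `⟪·, θ⟫` over the remaining points never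
increases along the path, and its total drop is at most `‖θ‖ * diam X`. Each step forces a drop of
at least its own length for all `θ` in its `descentSet`, whose volume is at least `4⁻ᵈ` times that
of the unit ball. Integrating over `θ` bounds the length. The volume bound holds because the future
displacements make pairwise nonnegative inner products: their dual cone `K` then satisfies `K - K =
ℝ^d` with norm control. Finally `8 ^ d` is at most a constant times `d ^ (d / 2)`. -/

/-! ### Volume of the dual cone of vectors at pairwise non-obtuse angles. -/

open MeasureTheory Pointwise in
/-- If every vector of the unit ball is a difference of two vectors of norm at most one in an
additively closed cone `K`, then `K` fills at least the fraction `4⁻ᵈ` of the unit ball. -/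
theorem volume_closedBall_le_of_sub_cover {d : ℕ} {K : Set (Euc d)} (hK : MeasurableSet K)
    (hconv : Convex ℝ K) (hadd : ∀ a ∈ K, ∀ b ∈ K, a + b ∈ K)
    (hsmul : ∀ c : ℝ, 0 < c → ∀ a ∈ K, c • a ∈ K)
    (hcover : ∀ x : Euc d, ‖x‖ ≤ 1 → ∃ a ∈ K, ∃ b ∈ K, ‖a‖ ≤ 1 ∧ ‖b‖ ≤ 1 ∧ x = a - b) :
    volume.real (Metric.closedBall (0 : Euc d) 1) ≤
      4 ^ d * volume.real (K ∩ Metric.closedBall 0 1) := by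
  set B : Set (Euc d) := Metric.closedBall 0 1
  set A : Set (Euc d) := K ∩ B
  set A' : Set (Euc d) := K ∩ Metric.closedBall 0 2
  have mB : MeasurableSet B := Metric.isClosed_closedBall.measurableSet
  have mA : MeasurableSet A := hK.inter mB
  have mA' : MeasurableSet A' := hK.inter Metric.isClosed_closedBall.measurableSet
  have hscale : volume A' ≤ 2 ^ d * volume A := by
    have hsub : A' ⊆ (2 : ℝ) • A := by
      rintro z ⟨hz, hz2⟩
      refine Set.mem_smul_set.2 ⟨(2⁻¹ : ℝ) • z, ⟨hsmul _ (by norm_num) _ hz, ?_⟩, ?_⟩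
      · simp only [mem_closedBall_zero_iff] at hz2
        simp only [B, mem_closedBall_zero_iff, norm_smul]
        norm_num
        linarith
      · rw [smul_smul]; norm_num
    refine (measure_mono hsub).trans ?_
    rw [Measure.addHaar_smul]
    simp [ENNReal.ofReal_pow]
  -- Rogers–Shephard argument: the integral over `x` of the volume of `A' ∩ (x + A')` is `(volume
  -- A')²`, and for `x = a - b` in `B` this intersection contains `a + A`.
  have hfub : volume B * volume A ≤ volume A' * volume A' := by
    have hlow : ∀ x ∈ B, volume A ≤ ∫⁻ p, A'.indicator 1 p * A'.indicator 1 (p - x) := by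
      intro x hx
      obtain ⟨a, ha, b, hb, ha1, hb1, rfl⟩ := hcover x (by simpa [B] using hx)
      have htr : volume A = ∫⁻ p, A.indicator 1 (p - a) := by
        rw [lintegral_sub_right_eq_self (fun p => A.indicator (1 : Euc d → ENNReal) p) a,
          lintegral_indicator_one mA]
      rw [htr]
      refine lintegral_mono fun p => ?_
      by_cases hp : p - a ∈ A
      · have hpn : ‖p - a‖ ≤ 1 := by simpa [B] using hp.2
        have h1 : p ∈ A' := by
          refine ⟨by simpa using hadd _ hp.1 _ ha, ?_⟩
          rw [mem_closedBall_zero_iff]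
          calc ‖p‖ = ‖(p - a) + a‖ := by simp
            _ ≤ ‖p - a‖ + ‖a‖ := norm_add_le _ _
            _ ≤ 2 := by linarith
        have h2 : p - (a - b) ∈ A' := by
          have e : p - (a - b) = (p - a) + b := by abel
          rw [e]
          refine ⟨hadd _ hp.1 _ hb, ?_⟩
          rw [mem_closedBall_zero_iff]
          exact (norm_add_le _ _).trans (by linarith)
        simp [h1, h2, hp]
      · simp [hp]
    have hmeas : Measurable (Function.uncurry fun (x p : Euc d) =>
        A'.indicator (1 : Euc d → ENNReal) p * A'.indicator (1 : Euc d → ENNReal) (p - x)) := by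
      have h1 : Measurable (A'.indicator (1 : Euc d → ENNReal)) := measurable_one.indicator mA'
      exact (h1.comp measurable_snd).mul (h1.comp (measurable_snd.sub measurable_fst))
    calc volume B * volume A = ∫⁻ _ in B, volume A := by simp [mul_comm]
      _ ≤ ∫⁻ x in B, ∫⁻ p, A'.indicator 1 p * A'.indicator 1 (p - x) :=
          setLIntegral_mono' mB hlow
      _ ≤ ∫⁻ x, ∫⁻ p, A'.indicator 1 p * A'.indicator 1 (p - x) := setLIntegral_le_lintegral _ _
      _ = ∫⁻ p, ∫⁻ x, A'.indicator 1 p * A'.indicator 1 (p - x) :=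
          lintegral_lintegral_swap hmeas.aemeasurable
      _ = ∫⁻ p, A'.indicator 1 p * volume A' := by
          refine lintegral_congr fun p => ?_
          have h1 : Measurable (A'.indicator (1 : Euc d → ENNReal)) := measurable_one.indicator mA'
          have h2 : Measurable fun x => A'.indicator (1 : Euc d → ENNReal) (p - x) :=
            h1.comp (measurable_const.sub measurable_id)
          rw [lintegral_const_mul _ h2,
            lintegral_sub_left_eq_self (fun x => A'.indicator (1 : Euc d → ENNReal) x) p,
            lintegral_indicator_one mA']
      _ = volume A' * volume A' := by
          rw [lintegral_mul_const _ (measurable_one.indicator mA'), lintegral_indicator_one mA']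
  have fB : volume B ≠ ⊤ := measure_closedBall_lt_top.ne
  have fA : volume A ≠ ⊤ := ne_top_of_le_ne_top fB (measure_mono Set.inter_subset_right)
  have key : volume.real B * volume.real A ≤ (2 ^ d * volume.real A) * (2 ^ d * volume.real A) := by
    have h := ENNReal.toReal_mono (by finiteness) (hfub.trans (mul_le_mul' hscale hscale))
    simpa [ENNReal.toReal_mul, Measure.real] using h
  -- Needed to cancel one factor `volume A`: differences of points of `A` cover the unit ball, so
  -- the convex set `A` has full affine span and hence interior.
  have hpos : 0 < volume.real A := by
    have hAne : A.Nonempty := by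
      obtain ⟨a, ha, -, -, ha1, -⟩ := hcover 0 (by simp)
      exact ⟨a, ha, by simpa [B] using ha1⟩
    have hspan : affineSpan ℝ A = ⊤ := by
      rw [AffineSubspace.affineSpan_eq_top_iff_vectorSpan_eq_top_of_nonempty ℝ _ _ hAne,
        Submodule.eq_top_iff']
      intro v
      obtain ⟨a, ha, b, hb, ha1, hb1, hv⟩ := hcover ((‖v‖ + 1)⁻¹ • v) (by
        rw [norm_smul, norm_inv, Real.norm_of_nonneg (by positivity), inv_mul_le_one₀ (by positivity)]
        linarith)
      have hmem : a - b ∈ vectorSpan ℝ A :=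
        vsub_mem_vectorSpan ℝ ⟨ha, by simpa [B] using ha1⟩ ⟨hb, by simpa [B] using hb1⟩
      rw [← hv] at hmem
      exact (Submodule.smul_mem_iff _ (by positivity)).1 hmem
    have hint := ((hconv.inter (convex_closedBall 0 1)).interior_nonempty_iff_affineSpan_eq_top).2
      hspan
    exact ENNReal.toReal_pos (Measure.measure_pos_of_nonempty_interior volume hint).ne' fA
  have e : (4 : ℝ) ^ d = 2 ^ d * 2 ^ d := by rw [← mul_pow]; norm_num
  rw [e]
  exact le_of_mul_le_mul_right (key.trans_eq (by ring)) hpos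

/-- Moreau's decomposition for the dual cone of a family of vectors with pairwise nonnegative
inner products. -/
theorem exists_sub_of_inner_nonneg {d : ℕ} {Y : Set (Euc d)}
    (hY : ∀ y ∈ Y, ∀ z ∈ Y, 0 ≤ inner ℝ y z) (x : Euc d) (hx : ‖x‖ ≤ 1) :
    ∃ a ∈ {η : Euc d | ∀ y ∈ Y, 0 ≤ inner ℝ y η}, ∃ b ∈ {η : Euc d | ∀ y ∈ Y, 0 ≤ inner ℝ y η},
      ‖a‖ ≤ 1 ∧ ‖b‖ ≤ 1 ∧ x = a - b := by
  set K : Set (Euc d) := {η | ∀ y ∈ Y, 0 ≤ inner ℝ y η} with hK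
  have hcl : IsClosed K := by
    have : K = ⋂ y ∈ Y, {η | 0 ≤ inner ℝ y η} := by ext; simp [hK]
    rw [this]
    exact isClosed_biInter fun y _ => isClosed_le continuous_const (by fun_prop)
  have hadd : ∀ a ∈ K, ∀ b ∈ K, a + b ∈ K := fun a ha b hb y hy => by
    rw [inner_add_right]; exact add_nonneg (ha y hy) (hb y hy)
  have hsmul : ∀ c : ℝ, 0 ≤ c → ∀ a ∈ K, c • a ∈ K := fun c hc a ha y hy => by
    rw [inner_smul_right]; exact mul_nonneg hc (ha y hy)
  have hconv : Convex ℝ K := fun a ha b hb s t hs ht _ => hadd _ (hsmul s hs a ha) _ (hsmul t ht b hb)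
  have h0 : (0 : Euc d) ∈ K := fun y _ => by simp
  obtain ⟨a, ha, hmin⟩ := exists_norm_eq_iInf_of_complete_convex ⟨0, h0⟩ hcl.isComplete hconv x
  rw [norm_eq_iInf_iff_real_inner_le_zero hconv ha] at hmin
  have hin : ∀ w ∈ K, inner ℝ (x - a) w ≤ 0 := fun w hw => by
    simpa using hmin _ (hadd _ hw _ ha)
  have horth : inner ℝ (x - a) a = 0 := by
    refine le_antisymm (hin a ha) ?_
    have := hmin 0 h0
    simpa using this
  have hpyth : ‖x‖ ^ 2 = ‖x - a‖ ^ 2 + ‖a‖ ^ 2 := by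
    have := norm_add_sq_real (x - a) a
    rw [horth] at this
    simpa using this
  refine ⟨a, ha, a - x, fun y hy => ?_, ?_, ?_, by abel⟩
  -- Pairwise nonnegativity says `Y ⊆ K`, so the polar inequality `hin` can be tested on `y` itself.
  · have := hin y (fun z hz => hY z hz y hy)
    rw [← neg_sub x a, inner_neg_right, real_inner_comm]
    linarith
  · nlinarith [norm_nonneg x, norm_nonneg a, sq_nonneg ‖x - a‖]
  · rw [norm_sub_rev]
    nlinarith [norm_nonneg x, norm_nonneg (x - a), sq_nonneg ‖a‖]

/-! ### Length of projection paths. -/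

section SelfContracted

variable {d : ℕ} {x : ℕ → Euc d} {m n : ℕ}

/-- `x m, …, x n` are such that each step moves towards all later points in the sense of
projections onto nested convex sets. -/
def IsProjectionPath (x : ℕ → Euc d) (m n : ℕ) : Prop :=
  ∀ t s, m ≤ t → t < s → s ≤ n → 0 ≤ inner ℝ (x (t + 1) - x t) (x s - x (t + 1))

theorem IsProjectionPath.norm_succ_sub_le (h : IsProjectionPath x m n) {t r : ℕ} (hmt : m ≤ t)
    (htr : t < r) (hrn : r ≤ n) : ‖x (t + 1) - x r‖ ≤ ‖x t - x r‖ := by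
  have h1 := h t r hmt htr hrn
  have e : x r - x t = (x (t + 1) - x t) + (x r - x (t + 1)) := by abel
  have h2 := norm_add_sq_real (x (t + 1) - x t) (x r - x (t + 1))
  rw [← e] at h2
  rw [norm_sub_rev, norm_sub_rev (x t)]
  nlinarith [norm_nonneg (x r - x t), norm_nonneg (x r - x (t + 1)), sq_nonneg ‖x (t + 1) - x t‖]

theorem IsProjectionPath.norm_sub_antitone (h : IsProjectionPath x m n) {t s r : ℕ} (hmt : m ≤ t)
    (hts : t ≤ s) (hsr : s ≤ r) (hrn : r ≤ n) : ‖x s - x r‖ ≤ ‖x t - x r‖ := by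
  induction s, hts using Nat.le_induction with
  | base => exact le_rfl
  | succ s hs ih =>
    exact (h.norm_succ_sub_le (hmt.trans hs) (by omega) hrn).trans (ih (by omega))

/-- For `s ≤ r`, expanding `‖x s - x r‖² ≤ ‖x t - x r‖²` around `x t` gives twice the inner product
at least `‖x s - x t‖²`. -/
theorem IsProjectionPath.inner_nonneg (h : IsProjectionPath x m n) {t s r : ℕ} (hmt : m ≤ t)
    (hts : t ≤ s) (htr : t ≤ r) (hs : s ≤ n) (hr : r ≤ n) :
    0 ≤ inner ℝ (x s - x t) (x r - x t) := by
  wlog hsr : s ≤ r generalizing s r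
  · rw [real_inner_comm]
    exact this htr hts hr hs (by omega)
  have h1 := h.norm_sub_antitone hmt hts hsr hr
  have e : x r - x s = (x r - x t) - (x s - x t) := by abel
  have h2 := norm_sub_sq_real (x r - x t) (x s - x t)
  rw [← e, real_inner_comm] at h2
  rw [norm_sub_rev, norm_sub_rev (x t)] at h1
  nlinarith [norm_nonneg (x r - x t), norm_nonneg (x r - x s), sq_nonneg ‖x s - x t‖]

/-- The directions in which the step from `x t` to `x (t + 1)` decreases the support function of
the future points by at least the length of the step. -/
def descentSet (x : ℕ → Euc d) (n t : ℕ) : Set (Euc d) :=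
  {θ | ‖θ‖ ≤ 2 ∧ ∀ s, t < s → s ≤ n → ‖x (t + 1) - x t‖ ≤ inner ℝ (x t - x s) θ}

theorem isClosed_descentSet (x : ℕ → Euc d) (n t : ℕ) : IsClosed (descentSet x n t) := by
  have e : descentSet x n t = {θ | ‖θ‖ ≤ 2} ∩ ⋂ s, ⋂ (_ : t < s), ⋂ (_ : s ≤ n),
      {θ | ‖x (t + 1) - x t‖ ≤ inner ℝ (x t - x s) θ} := by
    ext; simp [descentSet]
  rw [e]
  exact (isClosed_le continuous_norm continuous_const).inter <| isClosed_iInter fun s =>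
    isClosed_iInter fun _ => isClosed_iInter fun _ => isClosed_le continuous_const (by fun_prop)

-- With `u` the unit vector of the step, every future displacement has component at least the step
-- length along `u` and a nonnegative product with each `η` in the dual cone `K`. Hence `-u - η` is
-- a descent direction, and the reflected translate of `K ∩ closedBall 0 1` fits into the descent
-- set.
open MeasureTheory in
theorem IsProjectionPath.volume_descentSet_ge (h : IsProjectionPath x m n) {t : ℕ} (hmt : m ≤ t)
    (hne : x (t + 1) ≠ x t) :
    volume.real (Metric.closedBall (0 : Euc d) 1) ≤ 4 ^ d * volume.real (descentSet x n t) := by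
  set Y : Set (Euc d) := {y | ∃ s, t < s ∧ s ≤ n ∧ y = x s - x t}
  have hY : ∀ y ∈ Y, ∀ z ∈ Y, 0 ≤ inner ℝ y z := by
    rintro _ ⟨s, hts, hs, rfl⟩ _ ⟨r, htr, hr, rfl⟩
    exact h.inner_nonneg hmt hts.le htr.le hs hr
  set K : Set (Euc d) := {η | ∀ y ∈ Y, 0 ≤ inner ℝ y η} with hK
  have hcl : IsClosed K := by
    have : K = ⋂ y ∈ Y, {η | 0 ≤ inner ℝ y η} := by ext; simp [hK]
    rw [this]
    exact isClosed_biInter fun y _ => isClosed_le continuous_const (by fun_prop)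
  have hadd : ∀ a ∈ K, ∀ b ∈ K, a + b ∈ K := fun a ha b hb y hy => by
    rw [inner_add_right]; exact add_nonneg (ha y hy) (hb y hy)
  have hsmul : ∀ c : ℝ, 0 ≤ c → ∀ a ∈ K, c • a ∈ K := fun c hc a ha y hy => by
    rw [inner_smul_right]; exact mul_nonneg hc (ha y hy)
  have hconv : Convex ℝ K := fun a ha b hb s t hs ht _ =>
    hadd _ (hsmul s hs a ha) _ (hsmul t ht b hb)
  refine (volume_closedBall_le_of_sub_cover hcl.measurableSet hconv hadd
    (fun c hc => hsmul c hc.le) (exists_sub_of_inner_nonneg hY)).trans ?_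
  refine mul_le_mul_of_nonneg_left ?_ (by positivity)
  set l : ℝ := ‖x (t + 1) - x t‖ with hl
  have hlpos : 0 < l := norm_pos_iff.2 (sub_ne_zero.2 hne)
  set u : Euc d := l⁻¹ • (x (t + 1) - x t) with hu
  have hun : ‖u‖ = 1 := by
    rw [hu, norm_smul, norm_inv, Real.norm_of_nonneg hlpos.le]
    exact inv_mul_cancel₀ hlpos.ne'
  have hsub : K ∩ Metric.closedBall 0 1 ⊆ (fun η => -u - η) ⁻¹' descentSet x n t := by
    rintro η ⟨hη, hη1⟩
    rw [mem_closedBall_zero_iff] at hη1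
    refine ⟨?_, fun s hts hs => ?_⟩
    · refine (norm_sub_le _ _).trans ?_
      rw [norm_neg, hun]; linarith
    · have h1 : 0 ≤ inner ℝ (x s - x t) η := hη _ ⟨s, hts, hs, rfl⟩
      have h2 : l ≤ inner ℝ (x s - x t) u := by
        have h3 := h t s hmt hts hs
        have e : x s - x t = (x s - x (t + 1)) + (x (t + 1) - x t) := by abel
        rw [hu, inner_smul_right, e, inner_add_left, real_inner_self_eq_norm_sq, ← hl,
          real_inner_comm, inv_mul_eq_div, le_div_iff₀ hlpos]
        nlinarith
      rw [← neg_sub (x s), inner_neg_left, inner_sub_right, inner_neg_right]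
      linarith
  have hmp : MeasurePreserving (fun η : Euc d => -u - η) volume volume :=
    Measure.measurePreserving_sub_left volume (-u)
  have hfin : volume (descentSet x n t) ≠ ⊤ := by
    refine ne_top_of_le_ne_top (measure_closedBall_lt_top (x := (0 : Euc d)) (r := 2)).ne
      (measure_mono fun θ hθ => ?_)
    simpa using hθ.1
  refine ENNReal.toReal_mono hfin ((measure_mono hsub).trans_eq ?_)
  exact hmp.measure_preimage (isClosed_descentSet x n t).nullMeasurableSet

/-- Backward telescoping: `s` plays the role of the point maximizing `⟪·, θ⟫` on the remaining path.
When `θ` is a descent direction at `k`, moving the witness from `s` to `k` gains at least the step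
length; otherwise the witness stays. -/
theorem sum_indicator_descentSet_le (θ : Euc d) (hmn : m ≤ n) :
    ∃ s, m ≤ s ∧ s ≤ n ∧
      ∑ t ∈ Finset.Ico m n, (descentSet x n t).indicator (fun _ => ‖x (t + 1) - x t‖) θ ≤
        inner ℝ (x s - x n) θ := by
  induction hmn using Nat.decreasingInduction with
  | self => exact ⟨n, le_rfl, le_rfl, by simp⟩
  | of_succ k hk ih =>
    obtain ⟨s, hks, hsn, hs⟩ := ih
    rw [Finset.sum_eq_sum_Ico_succ_bot hk]
    by_cases hθ : θ ∈ descentSet x n k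
    · refine ⟨k, le_rfl, hk.le, ?_⟩
      rw [Set.indicator_of_mem hθ]
      have h1 := hθ.2 s (by omega) hsn
      have e : x k - x n = (x k - x s) + (x s - x n) := by abel
      rw [e, inner_add_left]
      linarith
    · refine ⟨s, by omega, hsn, ?_⟩
      rw [Set.indicator_of_notMem hθ]
      linarith

open MeasureTheory in
/-- The length of a projection path in a set of diameter `D` is at most `2 * 8 ^ d * D`. -/
theorem IsProjectionPath.length_le (h : IsProjectionPath x m n) (hmn : m ≤ n) {D : ℝ}
    (hD : ∀ s, m ≤ s → s ≤ n → ‖x s - x n‖ ≤ D) :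
    ∑ t ∈ Finset.Ico m n, ‖x (t + 1) - x t‖ ≤ 2 * 8 ^ d * D := by
  set b : ℝ := volume.real (Metric.closedBall (0 : Euc d) 1) with hb
  have hbpos : 0 < b := ENNReal.toReal_pos (Metric.measure_closedBall_pos _ _ one_pos).ne'
    measure_closedBall_lt_top.ne
  have hD0 : 0 ≤ D := (norm_nonneg _).trans (hD n hmn le_rfl)
  set B2 : Set (Euc d) := Metric.closedBall 0 2 with hB2
  have hvol2 : volume.real B2 = 2 ^ d * b := by
    have := Measure.addHaar_real_closedBall' (volume : Measure (Euc d)) 0 (r := 2) (by norm_num)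
    rw [hB2, this, hb]
    simp
  have hsubB : ∀ t, descentSet x n t ⊆ B2 := fun t θ hθ => by simpa [hB2] using hθ.1
  have hfin : ∀ t, volume (descentSet x n t) ≠ ⊤ := fun t =>
    ne_top_of_le_ne_top measure_closedBall_lt_top.ne (measure_mono (hsubB t))
  have hm : ∀ t, MeasurableSet (descentSet x n t) := fun t => (isClosed_descentSet x n t).measurableSet
  have hint : ∀ t, Integrable
      ((descentSet x n t).indicator fun _ : Euc d => ‖x (t + 1) - x t‖) volume := fun t =>
    (integrable_indicator_iff (hm t)).2 (integrableOn_const (hfin t))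
  have hB2int : Integrable (B2.indicator fun _ : Euc d => 2 * D) volume :=
    (integrable_indicator_iff Metric.isClosed_closedBall.measurableSet).2
      (integrableOn_const measure_closedBall_lt_top.ne)
  -- Exchange sum and integral: pointwise the sum is at most `‖θ‖ * D ≤ 2 * D`, and it vanishes
  -- outside the ball of radius 2.
  have hle : ∑ t ∈ Finset.Ico m n, volume.real (descentSet x n t) * ‖x (t + 1) - x t‖ ≤
      2 ^ d * b * (2 * D) := by
    calc _ = ∑ t ∈ Finset.Ico m n, ∫ θ, (descentSet x n t).indicator
              (fun _ => ‖x (t + 1) - x t‖) θ :=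
          Finset.sum_congr rfl fun t _ => by
            rw [integral_indicator_const _ (hm t), smul_eq_mul]
      _ = ∫ θ, ∑ t ∈ Finset.Ico m n, (descentSet x n t).indicator
              (fun _ => ‖x (t + 1) - x t‖) θ :=
          (integral_finsetSum _ fun t _ => hint t).symm
      _ ≤ ∫ θ, B2.indicator (fun _ => 2 * D) θ := by
          refine integral_mono (integrable_finsetSum _ fun t _ => hint t) hB2int fun θ => ?_
          by_cases hθ : θ ∈ B2
          · obtain ⟨s, hms, hsn, hs⟩ := sum_indicator_descentSet_le (x := x) θ hmn
            rw [Set.indicator_of_mem hθ]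
            refine hs.trans ((real_inner_le_norm _ _).trans ?_)
            rw [hB2, mem_closedBall_zero_iff] at hθ
            nlinarith [hD s hms hsn, norm_nonneg (x s - x n), norm_nonneg θ]
          · rw [Set.indicator_of_notMem hθ]
            refine (Finset.sum_eq_zero fun t _ => ?_).le
            exact Set.indicator_of_notMem (fun hh => hθ (hsubB t hh)) _
      _ = 2 ^ d * b * (2 * D) := by
          rw [integral_indicator_const _ Metric.isClosed_closedBall.measurableSet, hvol2,
            smul_eq_mul]
  have hge : b * ∑ t ∈ Finset.Ico m n, ‖x (t + 1) - x t‖ ≤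
      4 ^ d * ∑ t ∈ Finset.Ico m n, volume.real (descentSet x n t) * ‖x (t + 1) - x t‖ := by
    rw [Finset.mul_sum, Finset.mul_sum]
    refine Finset.sum_le_sum fun t ht => ?_
    by_cases hne : x (t + 1) = x t
    · simp [hne]
    · rw [← mul_assoc]
      exact mul_le_mul_of_nonneg_right
        (h.volume_descentSet_ge (Finset.mem_Ico.1 ht).1 hne) (norm_nonneg _)
  have e8 : (8 : ℝ) ^ d = 4 ^ d * 2 ^ d := by rw [← mul_pow]; norm_num
  refine le_of_mul_le_mul_left (hge.trans ?_) hbpos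
  calc _ ≤ (4 : ℝ) ^ d * (2 ^ d * b * (2 * D)) := by gcongr
    _ = b * (2 * 8 ^ d * D) := by rw [e8]; ring

end SelfContracted

/-! ### Levels, phases and cost of the algorithm. -/

theorem inner_metricProj_nonneg {d : ℕ} {K : Set (Euc d)} (hne : K.Nonempty) (hc : IsClosed K)
    (hconv : Convex ℝ K) (x : Euc d) {z : Euc d} (hz : z ∈ K) :
    0 ≤ inner ℝ (metricProj K x - x) (z - metricProj K x) := by
  obtain ⟨hp, hmin⟩ := metricProj_spec hne hc x
  have : Nonempty K := hne.to_subtype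
  have h : ‖x - metricProj K x‖ = ⨅ w : K, ‖x - w‖ :=
    le_antisymm (le_ciInf fun w => hmin w w.2)
      (ciInf_le ⟨0, by rintro _ ⟨w, rfl⟩; positivity⟩ (⟨_, hp⟩ : K))
  have := (norm_eq_iInf_iff_real_inner_le_zero hconv hp).1 h z hz
  rw [← neg_sub x, inner_neg_left]
  linarith

section LSP

variable {d : ℕ} {X : Set (Euc d)} {G : ℝ≥0} {T : ℕ} {f : Euc d → ℝ} {S : ℕ → Set (Euc d)}
  {x₀ : Euc d} {ε : ℝ}

theorem exists_level_eq_minValue (hT : 1 ≤ T) {t : ℕ} (ht : t ≤ T) :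
    ∃ r ≤ T, (lspState f ε S x₀ t).level = minValue f (S r) := by
  induction t with
  | zero => exact ⟨1, hT, rfl⟩
  | succ t ih =>
    simp only [lspState, lspStep]
    split_ifs
    · exact ⟨t + 1, ht, rfl⟩
    · exact ih (by omega)

namespace IsCONESInput

theorem subset_of_le (h : IsCONESInput X G T f S) {s t : ℕ} (hst : s ≤ t) (ht : t ≤ T) :
    S t ⊆ S s := by
  induction t, hst using Nat.le_induction with
  | base => exact le_rfl
  | succ t _ ih => exact (h.nested t (by omega)).trans (ih (by omega))

theorem subset (h : IsCONESInput X G T f S) {t : ℕ} (ht : t ≤ T) : S t ⊆ X :=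
  h.start ▸ h.subset_of_le (Nat.zero_le t) ht

theorem nonempty_of_le (h : IsCONESInput X G T f S) {t : ℕ} (ht : t ≤ T) : (S t).Nonempty :=
  h.nonempty.mono (h.subset_of_le ht le_rfl)

theorem continuousOn (h : IsCONESInput X G T f S) {t : ℕ} (ht : t ≤ T) : ContinuousOn f (S t) :=
  h.lipschitz.continuousOn.mono (h.subset ht)

theorem exists_minValue (h : IsCONESInput X G T f S) (hX : IsCompact X) {t : ℕ} (ht : t ≤ T) :
    ∃ x ∈ S t, f x = minValue f (S t) ∧ ∀ y ∈ S t, f x ≤ f y :=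
  exists_eq_minValue (hX.of_isClosed_subset (h.isClosed t ht) (h.subset ht)) (h.nonempty_of_le ht)
    (h.continuousOn ht)

theorem minValue_mono (h : IsCONESInput X G T f S) (hX : IsCompact X) {s t : ℕ} (hst : s ≤ t)
    (ht : t ≤ T) : minValue f (S s) ≤ minValue f (S t) := by
  obtain ⟨x, hx, hfx, -⟩ := h.exists_minValue hX ht
  obtain ⟨y, -, hfy, hy⟩ := h.exists_minValue hX (hst.trans ht)
  rw [← hfx, ← hfy]
  exact hy x (h.subset_of_le hst ht hx)

theorem minValue_sub_le (h : IsCONESInput X G T f S) (hX : IsCompact X) {s t : ℕ} (hs : s ≤ T)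
    (ht : t ≤ T) : minValue f (S t) - minValue f (S s) ≤ G * Metric.diam X := by
  obtain ⟨x, hx, hfx, -⟩ := h.exists_minValue hX ht
  obtain ⟨y, hy, hfy, -⟩ := h.exists_minValue hX hs
  rw [← hfx, ← hfy]
  have h1 := h.lipschitz.dist_le_mul x (h.subset ht hx) y (h.subset hs hy)
  have h2 := Metric.dist_le_diam_of_mem hX.isBounded (h.subset ht hx) (h.subset hs hy)
  rw [Real.dist_eq] at h1
  exact (le_abs_self _).trans (h1.trans (by gcongr))

theorem isClosed_activeSet (h : IsCONESInput X G T f S) {t : ℕ} (ht : t ≤ T) (L : ℝ) :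
    IsClosed (activeSet f ε L (S t)) :=
  (h.continuousOn ht).preimage_isClosed_of_isClosed (h.isClosed t ht) isClosed_Iic

theorem convex_activeSet (h : IsCONESInput X G T f S) {t : ℕ} (ht : t ≤ T) (L : ℝ) :
    Convex ℝ (activeSet f ε L (S t)) :=
  (h.convexOn.subset (h.subset ht) (h.convex t ht)).convex_le (L + ε)

theorem nonempty_activeSet_minValue (h : IsCONESInput X G T f S) (hX : IsCompact X) (hε : 0 < ε)
    {t : ℕ} (ht : t ≤ T) : (activeSet f ε (minValue f (S t)) (S t)).Nonempty := by
  obtain ⟨x, hx, hfx, -⟩ := h.exists_minValue hX ht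
  exact ⟨x, hx, by linarith⟩

theorem lt_minValue (h : IsCONESInput X G T f S) (hX : IsCompact X) {t : ℕ} (ht : t ≤ T) {L : ℝ}
    (hL : activeSet f ε L (S t) = ∅) : L + ε < minValue f (S t) := by
  obtain ⟨x, hx, hfx, -⟩ := h.exists_minValue hX ht
  rw [← hfx]
  by_contra! hle
  exact Set.eq_empty_iff_forall_notMem.1 hL x ⟨hx, hle⟩

/-- After each round the active set at the current level is nonempty, and the action is the
projection onto it of the previous action. -/
theorem lspAction_succ (h : IsCONESInput X G T f S) (hX : IsCompact X) (hε : 0 < ε) {t : ℕ}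
    (ht : t < T) :
    (activeSet f ε (lspState f ε S x₀ (t + 1)).level (S (t + 1))).Nonempty ∧
      lspAction f ε S x₀ (t + 1) =
        metricProj (activeSet f ε (lspState f ε S x₀ (t + 1)).level (S (t + 1)))
          (lspAction f ε S x₀ t) := by
  simp only [lspAction, lspState, lspStep]
  split_ifs with hem
  · exact ⟨h.nonempty_activeSet_minValue hX hε ht, rfl⟩
  · exact ⟨Set.nonempty_iff_ne_empty.2 hem, rfl⟩

theorem lspAction_succ_mem (h : IsCONESInput X G T f S) (hX : IsCompact X) (hε : 0 < ε) {t : ℕ}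
    (ht : t < T) : lspAction f ε S x₀ (t + 1) ∈
      activeSet f ε (lspState f ε S x₀ (t + 1)).level (S (t + 1)) := by
  obtain ⟨hne, heq⟩ := h.lspAction_succ (x₀ := x₀) hX hε ht
  rw [heq]
  exact (metricProj_spec hne (h.isClosed_activeSet ht _) _).1

theorem lspAction_mem (h : IsCONESInput X G T f S) (hX : IsCompact X) (hε : 0 < ε)
    (hx₀ : x₀ ∈ X) {t : ℕ} (ht : t ≤ T) : lspAction f ε S x₀ t ∈ S t := by
  cases t with
  | zero => rw [h.start]; exact hx₀
  | succ t => exact (h.lspAction_succ_mem hX hε ht).1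

/-- Projections onto the active sets of a fixed level form a projection path. -/
theorem isProjectionPath (h : IsCONESInput X G T f S) {x : ℕ → Euc d} {L : ℝ} {a b : ℕ}
    (hb : b ≤ T)
    (hx : ∀ s, a ≤ s → s < b → (activeSet f ε L (S (s + 1))).Nonempty ∧
      x (s + 1) = metricProj (activeSet f ε L (S (s + 1))) (x s)) :
    IsProjectionPath x a b := by
  intro t s hat hts hsb
  obtain ⟨s, rfl⟩ : ∃ k, s = k + 1 := ⟨s - 1, by omega⟩
  obtain ⟨hne, heq⟩ := hx t hat (by omega)
  obtain ⟨hne', heq'⟩ := hx s (by omega) (by omega)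
  have hmem : x (s + 1) ∈ activeSet f ε L (S (s + 1)) := by
    rw [heq']
    exact (metricProj_spec hne' (h.isClosed_activeSet (by omega) _) _).1
  -- At a fixed level the active sets are nested, so later actions are competitors in the earlier
  -- projection.
  have hmem' : x (s + 1) ∈ activeSet f ε L (S (t + 1)) :=
    ⟨h.subset_of_le (by omega) (by omega) hmem.1, hmem.2⟩
  have := inner_metricProj_nonneg hne (h.isClosed_activeSet (by omega) _)
    (h.convex_activeSet (by omega) _) (x t) hmem'
  rwa [← heq] at this

theorem length_le_of_projections (h : IsCONESInput X G T f S) (hX : IsCompact X)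
    {x : ℕ → Euc d} (hxX : ∀ s ≤ T, x s ∈ X) {L : ℝ} {a b : ℕ} (hab : a ≤ b) (hb : b ≤ T)
    (hx : ∀ s, a ≤ s → s < b → (activeSet f ε L (S (s + 1))).Nonempty ∧
      x (s + 1) = metricProj (activeSet f ε L (S (s + 1))) (x s)) :
    ∑ t ∈ Finset.Ico a b, ‖x (t + 1) - x t‖ ≤ 2 * 8 ^ d * Metric.diam X := by
  refine (h.isProjectionPath hb hx).length_le hab fun s _ hs => ?_
  rw [← dist_eq_norm]
  exact Metric.dist_le_diam_of_mem hX.isBounded (hxX s (by omega)) (hxX b hb)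

/-- A phase ends only when `f > L + ε` on all of the revealed set, so each phase change raises the
level by more than `ε`. -/
theorem level_ge (h : IsCONESInput X G T f S) (hX : IsCompact X) {t : ℕ} (ht : t ≤ T) :
    minValue f (S 1) + ((lspState f ε S x₀ t).phase - 1) * ε ≤ (lspState f ε S x₀ t).level := by
  induction t with
  | zero => simp [lspState]
  | succ t ih =>
    have ih := ih (by omega)
    simp only [lspState, lspStep]
    split_ifs with hem
    · have := h.lt_minValue hX ht hem
      push_cast
      linarith
    · exact ih

/-- The current phase started after some round `a`, and every earlier phase moved by at most
`2 * 8 ^ d * diam X`. -/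
theorem exists_phase_start (h : IsCONESInput X G T f S) (hX : IsCompact X) (hε : 0 < ε)
    (hx₀ : x₀ ∈ X) {t : ℕ} (ht : t ≤ T) :
    ∃ a ≤ t,
      (∀ s, a ≤ s → s < t →
        (activeSet f ε (lspState f ε S x₀ t).level (S (s + 1))).Nonempty ∧
        lspAction f ε S x₀ (s + 1) =
          metricProj (activeSet f ε (lspState f ε S x₀ t).level (S (s + 1)))
            (lspAction f ε S x₀ s)) ∧
      ∑ s ∈ Finset.Ico 0 a, ‖lspAction f ε S x₀ (s + 1) - lspAction f ε S x₀ s‖ ≤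
        ((lspState f ε S x₀ t).phase - 1) * (2 * 8 ^ d * Metric.diam X) := by
  have hmem : ∀ s ≤ T, lspAction f ε S x₀ s ∈ X := fun s hs =>
    h.subset hs (h.lspAction_mem hX hε hx₀ hs)
  induction t with
  | zero => exact ⟨0, le_rfl, fun s _ hs => absurd hs (Nat.not_lt_zero s), by simp [lspState]⟩
  | succ t ih =>
    obtain ⟨a, hat, hproj, hsum⟩ := ih (by omega)
    have hnew := h.lspAction_succ (x₀ := x₀) hX hε ht
    by_cases hem : activeSet f ε (lspState f ε S x₀ t).level (S (t + 1)) = ∅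
    -- The step from `t` to `t + 1` already uses the new level, so the new phase path starts at `x
    -- t`; the old one, from `a` to `t`, is closed and charged once.
    · refine ⟨t, by omega, fun s hs hs' => ?_, ?_⟩
      · obtain rfl : s = t := by omega
        exact hnew
      · have hphase : (lspState f ε S x₀ (t + 1)).phase = (lspState f ε S x₀ t).phase + 1 := by
          simp only [lspState, lspStep, if_pos hem]
        have hlen := h.length_le_of_projections hX hmem hat (by omega) hproj
        rw [hphase, ← Finset.sum_Ico_consecutive _ (Nat.zero_le a) hat]
        push_cast
        linarith
    · have hphase : (lspState f ε S x₀ (t + 1)).phase = (lspState f ε S x₀ t).phase := by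
        simp only [lspState, lspStep, if_neg hem]
      have hlevel : (lspState f ε S x₀ (t + 1)).level = (lspState f ε S x₀ t).level := by
        simp only [lspState, lspStep, if_neg hem]
      refine ⟨a, by omega, fun s hs hs' => ?_, by rwa [hphase]⟩
      rcases (Nat.lt_succ_iff.1 hs').lt_or_eq with hlt | rfl
      · rw [hlevel]; exact hproj s hs hlt
      · exact hnew

theorem movementCost_le (h : IsCONESInput X G T f S) (hX : IsCompact X) (hε : 0 < ε)
    (hx₀ : x₀ ∈ X) :
    movementCost (lspAction f ε S x₀) T ≤
      2 * 8 ^ d * Metric.diam X * (G * Metric.diam X / ε + 1) := by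
  have hmem : ∀ s ≤ T, lspAction f ε S x₀ s ∈ X := fun s hs =>
    h.subset hs (h.lspAction_mem hX hε hx₀ hs)
  have hc : 0 ≤ 2 * 8 ^ d * Metric.diam X := by positivity
  -- For `T = 0` the initial level refers to `S 1`, about which nothing is known.
  rcases Nat.eq_zero_or_pos T with rfl | hT
  · simp only [movementCost, Finset.Icc_eq_empty_of_lt one_pos, Finset.sum_empty]
    positivity
  obtain ⟨a, haT, hproj, hsum⟩ := h.exists_phase_start hX hε hx₀ le_rfl
  have hlen := h.length_le_of_projections hX hmem haT le_rfl hproj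
  have hphase : ((lspState f ε S x₀ T).phase : ℝ) - 1 ≤ G * Metric.diam X / ε := by
    obtain ⟨r, hrT, e⟩ := exists_level_eq_minValue (f := f) (S := S) (ε := ε) (x₀ := x₀) hT le_rfl
    have h1 := h.level_ge (ε := ε) (x₀ := x₀) hX le_rfl
    have h2 := h.minValue_sub_le hX hT hrT
    rw [le_div_iff₀ hε]
    linarith
  have hmove : movementCost (lspAction f ε S x₀) T =
      ∑ s ∈ Finset.Ico 0 T, ‖lspAction f ε S x₀ (s + 1) - lspAction f ε S x₀ s‖ := by
    rw [movementCost, ← Finset.Ico_add_one_right_eq_Icc, Finset.sum_Ico_eq_sum_range,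
      ← Finset.range_eq_Ico]
    simp [add_comm 1]
  rw [hmove, ← Finset.sum_Ico_consecutive _ (Nat.zero_le a) haT]
  calc _ ≤ ((lspState f ε S x₀ T).phase - 1) * (2 * 8 ^ d * Metric.diam X) +
        2 * 8 ^ d * Metric.diam X := add_le_add hsum hlen
    _ ≤ G * Metric.diam X / ε * (2 * 8 ^ d * Metric.diam X) + 2 * 8 ^ d * Metric.diam X := by
        gcongr
    _ = _ := by ring

theorem lossCost_sub_le (h : IsCONESInput X G T f S) (hX : IsCompact X) (hε : 0 < ε) :
    lossCost f (lspAction f ε S x₀) T - optLossCost f S T ≤ T * ε := by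
  have hle : lossCost f (lspAction f ε S x₀) T ≤
      ∑ t ∈ Finset.Icc 1 T, (minValue f (S T) + ε) := by
    refine Finset.sum_le_sum fun t ht => ?_
    obtain ⟨h1, hT⟩ := Finset.mem_Icc.1 ht
    obtain ⟨t, rfl⟩ : ∃ k, t = k + 1 := ⟨t - 1, by omega⟩
    obtain ⟨r, hrT, e⟩ := exists_level_eq_minValue (f := f) (S := S) (ε := ε) (x₀ := x₀) (h1.trans hT) hT
    have h2 := (h.lspAction_succ_mem (x₀ := x₀) hX hε hT).2
    rw [e] at h2
    linarith [h.minValue_mono hX hrT le_rfl]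
  rw [Finset.sum_const, Nat.card_Icc, nsmul_eq_mul, Nat.add_sub_cancel] at hle
  rw [optLossCost]
  linarith

end IsCONESInput

theorem lspRegret_le (hX : IsCompact X) (hε : 0 < ε) :
    lspRegret X G x₀ ε T ≤ ((T * ε : ℝ) : EReal) :=
  iSup_le fun _ => iSup_le fun _ => iSup_le fun h => EReal.coe_le_coe_iff.2 (h.lossCost_sub_le hX hε)

end LSP

/-! ### Constants and conclusion. -/

/-- The threshold is `d = 64`, since `8 ^ d = 64 ^ (d / 2)`; smaller dimensions are absorbed into `8
^ 64`. -/
theorem eight_pow_le (d : ℕ) : (8 : ℝ) ^ d ≤ 8 ^ 64 * (d : ℝ) ^ ((d : ℝ) / 2) := by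
  rcases Nat.eq_zero_or_pos d with rfl | hd
  · norm_num
  have h1 : (1 : ℝ) ≤ (d : ℝ) ^ ((d : ℝ) / 2) :=
    Real.one_le_rpow (by exact_mod_cast hd) (by positivity)
  rcases le_total d 64 with hle | hle
  · calc (8 : ℝ) ^ d ≤ 8 ^ 64 * 1 := by
          rw [mul_one]; exact pow_le_pow_right₀ (by norm_num) hle
      _ ≤ _ := by gcongr
  · have e : (8 : ℝ) ^ d = (64 : ℝ) ^ ((d : ℝ) / 2) := by
      rw [show (64 : ℝ) = 8 ^ (2 : ℝ) by norm_num, ← Real.rpow_mul (by norm_num),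
        mul_div_cancel₀ _ (by norm_num), Real.rpow_natCast]
    calc (8 : ℝ) ^ d = (64 : ℝ) ^ ((d : ℝ) / 2) := e
      _ ≤ (d : ℝ) ^ ((d : ℝ) / 2) := by
          refine Real.rpow_le_rpow (by norm_num) (by exact_mod_cast hle) (by positivity)
      _ ≤ _ := le_mul_of_one_le_left (by positivity) (by norm_num)

theorem mainTheorem5 :
    ∃ C : ℝ, 0 < C ∧
      ∀ (d : ℕ) (X : Set (Euc d)) (x₀ : Euc d) (G : ℝ≥0) (T : ℕ),
        IsCompact X → Convex ℝ X → x₀ ∈ X →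
        (∀ ε : ℝ, 0 < ε →
          lspRegret X G x₀ ε T ≤ ((T * ε : ℝ) : EReal) ∧
          ∀ (f : Euc d → ℝ) (S : ℕ → Set (Euc d)), IsCONESInput X G T f S →
            (∀ t : ℕ, 1 ≤ t → t ≤ T → lspAction f ε S x₀ t ∈ S t) ∧
            movementCost (lspAction f ε S x₀) T ≤
              C * (d : ℝ) ^ ((d : ℝ) / 2) * Metric.diam X * (G * Metric.diam X / ε + 1) ∧
            (ε ≤ G * Metric.diam X →
              movementCost (lspAction f ε S x₀) T ≤
                C * ((d : ℝ) ^ ((d : ℝ) / 2) * G * Metric.diam X ^ 2 / ε))) ∧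
        (∀ β : ℝ, 0 ≤ β → β ≤ 1 → 1 ≤ T →
          lspRegret X G x₀ ((T : ℝ) ^ (-β)) T ≤ (((T : ℝ) ^ (1 - β) : ℝ) : EReal) ∧
          ∀ (f : Euc d → ℝ) (S : ℕ → Set (Euc d)), IsCONESInput X G T f S →
            movementCost (lspAction f ((T : ℝ) ^ (-β)) S x₀) T ≤
              C * (d : ℝ) ^ ((d : ℝ) / 2) * Metric.diam X * (G * Metric.diam X + 1) *
                (T : ℝ) ^ β) := by
  -- One factor 2 comes from the path length, the other from absorbing `+ 1` into `G * diam X / ε`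
  -- when `ε ≤ G * diam X`.
  refine ⟨4 * 8 ^ 64, by positivity, fun d X x₀ G T hX _ hx₀ => ?_⟩
  have h8 := eight_pow_le d
  have hmove : ∀ ε : ℝ, 0 < ε → ∀ (f : Euc d → ℝ) (S : ℕ → Set (Euc d)),
      IsCONESInput X G T f S → movementCost (lspAction f ε S x₀) T ≤
        2 * 8 ^ 64 * (d : ℝ) ^ ((d : ℝ) / 2) * Metric.diam X * (G * Metric.diam X / ε + 1) := by
    intro ε hε f S h
    refine (h.movementCost_le hX hε hx₀).trans ?_
    gcongr ?_ * _ * _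
    linarith
  have hmove' : ∀ ε : ℝ, 0 < ε → ∀ (f : Euc d → ℝ) (S : ℕ → Set (Euc d)),
      IsCONESInput X G T f S → movementCost (lspAction f ε S x₀) T ≤
        4 * 8 ^ 64 * (d : ℝ) ^ ((d : ℝ) / 2) * Metric.diam X * (G * Metric.diam X / ε + 1) := by
    intro ε hε f S h
    refine (hmove ε hε f S h).trans ?_
    gcongr
    norm_num
  refine ⟨fun ε hε => ⟨lspRegret_le hX hε, fun f S h =>
    ⟨fun t _ ht => h.lspAction_mem hX hε hx₀ ht, hmove' ε hε f S h, fun hεG => ?_⟩⟩,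
    fun β hβ _ hT => ?_⟩
  · refine (hmove ε hε f S h).trans ?_
    have h1 : 1 ≤ G * Metric.diam X / ε := (one_le_div hε).2 hεG
    calc 2 * 8 ^ 64 * (d : ℝ) ^ ((d : ℝ) / 2) * Metric.diam X * (G * Metric.diam X / ε + 1)
        ≤ 2 * 8 ^ 64 * (d : ℝ) ^ ((d : ℝ) / 2) * Metric.diam X *
            (G * Metric.diam X / ε + G * Metric.diam X / ε) := by gcongr
      _ = _ := by ring
  · have hT1 : (1 : ℝ) ≤ T := by exact_mod_cast hT
    have hT0 : (0 : ℝ) < T := by linarith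
    have hε : 0 < (T : ℝ) ^ (-β) := by positivity
    refine ⟨?_, fun f S h => (hmove' _ hε f S h).trans ?_⟩
    · have e : (T : ℝ) ^ (1 - β) = T * (T : ℝ) ^ (-β) := by
        rw [sub_eq_add_neg, Real.rpow_add hT0, Real.rpow_one]
      rw [e]
      exact lspRegret_le hX hε
    · have h1 : (1 : ℝ) ≤ (T : ℝ) ^ β := Real.one_le_rpow hT1 hβ
      rw [Real.rpow_neg hT0.le, div_inv_eq_mul, mul_assoc _ (_ + 1 : ℝ)]
      gcongr
      rw [add_mul, one_mul]
      gcongr
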